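/- All quantum systems are finite dimensional, $\log$ is the binary logarithm, and a quantum channel is a completely positive trace-preserving (CPTP) linear map. Definitions. For states $\rho,\xi$ let $F(\rho,\xi)=\operatorname{Tr}\sqrt{\sqrt{\rho}\,\xi\,\sqrt{\rho}}$, and for $\alpha\in(0,1)\cup(1,\infty)$ let $S_\alpha(\rho)=\frac{1}{1-\alpha}\log\operatorname{Tr}\rho^\alpha$. The $\alpha$-Rényi entanglement of purification of a bipartite state $\rho^{AR}$ is $$E_{\alpha,p}(A:R)_\rho=\inf_{\mathcal N:B\to E}S_\alpha(AE)_\sigma,\qquad \sigma^{AE}=(\operatorname{id}_A\otimes\mathcal N)\rho^{AB},\quad \rho^{AB}=\operatorname{Tr}_R|\psi\rangle\langle\psi|^{ABR},$$ where $|\psi\rangle^{ABR}$ is a purification of $\rho^{AR}$ and the infimum is over such purifications and over all channels $\mathcal N$ from $B$ to an arbitrary finite-dimensional system $E$. Its regularization is $E^\infty_{\alpha,p}(A:R)_\rho=\lim_{n\to\infty}\frac1n E_{\alpha,p}(A^n:R^n)_{\rho^{\otimes n}}$. Let $\{p(x),\rho_x^A\}_{x\in X}$ be a finite ensemble of mixed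 states, with source state $\rho^{AR}=\sum_x p(x)\,\rho_x^A\otimes|x\rangle\langle x|^R$, where $\{|x\rangle\}_x$ is an orthonormal basis of $R$. For $x^n=(x_1,\dots,x_n)$ write $p(x^n)=\prod_i p(x_i)$ and $\rho_{x^n}=\rho_{x_1}\otimes\cdots\otimes\rho_{x_n}$. A visible compression scheme of block length $n\ge 1$ consists of a finite-dimensional system $M$, an encoding channel $\mathcal C:A^nC^n\to M$, where the side-information system $C$ has the orthonormal basis $\{|x\rangle\}_x$, and a decoding channel $\mathcal D:M\to A^n$. Its rate is $Q_v=\frac1n\log|M|$, where $|M|=\dim M$, and its average fidelity is $$\overline F_v=\sum_{x^n}p(x^n)\,F(\rho_{x^n},\xi_{x^n}),\qquad \xi_{x^n}=\mathcal D\big(\mathcal C(\rho_{x^n}\otimes|x^n\rangle\langle x^n|^{C^n})\big).$$ Theorem. For every such ensemble and every $\alpha>1$, the limit defining $E^\infty_{\alpha,p}(A:R)_\rho$ exists in $\mathbb R$, and for every $n\ge1$ every visible compression scheme of block length $n$ and rate $Q_v$ satisfies $$\overline F_v\le 2^{-n\frac{\alpha-1}{2\alpha}\left(E^\infty_{\alpha,p}(A:R)_\rho-Q_v\right)}.$$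 -/

import Mathlib

open Filter Topology
open scoped Kronecker ComplexConjugate ComplexOrder

universe u

noncomputable section

namespace VisibleCompression

/-! A finite-dimensional quantum system is given by the finite index type of an orthonormal basis;
operators on it are complex square matrices, and the joint system of `A` and `B` is `A × B`. -/

/-- Density operators: positive semidefinite matrices of trace one. -/
def IsDensity {A : Type*} [Fintype A] (ρ : Matrix A A ℂ) : Prop :=
  ρ.PosSemidef ∧ ρ.trace = 1

/-- The operator `(id_A ⊗ N) T` on `A ⊗ E`, for a linear map `N` from operators on `B` to operators
on `E` and an operator `T` on `A ⊗ B`: the map `N` is applied to every `B`-block of `T`. -/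
def idTensor {A B E : Type*} (N : Matrix B B ℂ →ₗ[ℂ] Matrix E E ℂ)
    (T : Matrix (A × B) (A × B) ℂ) : Matrix (A × E) (A × E) ℂ :=
  Matrix.of fun i j => N (Matrix.of fun k l => T (i.1, k) (j.1, l)) i.2 j.2

/-- Quantum channels: completely positive trace-preserving linear maps. -/
structure IsCPTP {B E : Type*} [Fintype B] [Fintype E]
    (N : Matrix B B ℂ →ₗ[ℂ] Matrix E E ℂ) : Prop where
  completelyPositive : ∀ (k : ℕ) (T : Matrix (Fin k × B) (Fin k × B) ℂ),
    T.PosSemidef → (idTensor N T).PosSemidef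
  tracePreserving : ∀ T : Matrix B B ℂ, (N T).trace = T.trace

/-- The root fidelity `F(ρ, ξ) = Tr √(√ρ ξ √ρ)` (not squared); square roots are taken by the
functional calculus for Hermitian matrices. -/
def fidelity {A : Type*} [Fintype A] [DecidableEq A] (ρ ξ : Matrix A A ℂ) : ℝ :=
  (cfc Real.sqrt (cfc Real.sqrt ρ * ξ * cfc Real.sqrt ρ)).trace.re

/-- The `α`-Rényi entropy `(1 - α)⁻¹ log₂ Tr ρ^α`, for positive `α ≠ 1`. -/
def renyiEntropy {A : Type*} [Fintype A] [DecidableEq A] (α : ℝ) (ρ : Matrix A A ℂ) : ℝ :=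
  1 / (1 - α) * Real.logb 2 (cfc (fun x : ℝ => x ^ α) ρ).trace.re

/-- The rank-one operator `|ψ⟩⟨ψ|`. -/
def ketBra {A : Type*} (ψ : A → ℂ) : Matrix A A ℂ :=
  Matrix.of fun i j => ψ i * conj (ψ j)

/-- The partial trace over `B` of an operator on `A ⊗ B ⊗ R`. -/
def traceMiddle {A B R : Type*} [Fintype B] (T : Matrix (A × B × R) (A × B × R) ℂ) :
    Matrix (A × R) (A × R) ℂ :=
  Matrix.of fun i j => ∑ b : B, T (i.1, b, i.2) (j.1, b, j.2)

/-- The partial trace over `R` of an operator on `A ⊗ B ⊗ R`. -/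
def traceLast {A B R : Type*} [Fintype R] (T : Matrix (A × B × R) (A × B × R) ℂ) :
    Matrix (A × B) (A × B) ℂ :=
  Matrix.of fun i j => ∑ r : R, T (i.1, i.2, r) (j.1, j.2, r)

/-- `ψ` in `A ⊗ B ⊗ R` is a purification of the state `ρ` on `A ⊗ R`. -/
def IsPurification {A B R : Type*} [Fintype B] (ψ : A × B × R → ℂ)
    (ρ : Matrix (A × R) (A × R) ℂ) : Prop :=
  traceMiddle (ketBra ψ) = ρ

/-- The `α`-Rényi entanglement of purification `E_{α,p}(A:R)_ρ` of a bipartite state: the infimum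
of `S_α(AE)_σ` over `σ = (id_A ⊗ N) ρ^{AB}`, where `N` is a channel from `B` to an arbitrary
finite-dimensional system `E` and `ρ^{AB} = Tr_R |ψ⟩⟨ψ|` for a purification `ψ` of `ρ`. -/
def renyiEoP {A R : Type u} [Fintype A] [DecidableEq A] [Fintype R]
    (α : ℝ) (ρ : Matrix (A × R) (A × R) ℂ) : ℝ :=
  sInf {s : ℝ | ∃ (B E : Type u) (_ : Fintype B) (_ : Fintype E) (_ : DecidableEq E)
    (ψ : A × B × R → ℂ) (N : Matrix B B ℂ →ₗ[ℂ] Matrix E E ℂ),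
      IsPurification ψ ρ ∧ IsCPTP N ∧
        s = renyiEntropy α (idTensor N (traceLast (ketBra ψ)))}

/-- The tensor power `ρ^{⊗n}` of a state on `A ⊗ R`, as a bipartite state on `A^n ⊗ R^n`. -/
def bipartitePow {A R : Type*} (n : ℕ) (ρ : Matrix (A × R) (A × R) ℂ) :
    Matrix ((Fin n → A) × (Fin n → R)) ((Fin n → A) × (Fin n → R)) ℂ :=
  Matrix.of fun i j => ∏ k : Fin n, ρ (i.1 k, i.2 k) (j.1 k, j.2 k)

/-- The regularized `α`-Rényi entanglement of purification
`lim_{n → ∞} E_{α,p}(A^n : R^n)_{ρ^{⊗n}} / n`. -/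
def regularizedRenyiEoP {A R : Type u} [Fintype A] [DecidableEq A] [Fintype R]
    (α : ℝ) (ρ : Matrix (A × R) (A × R) ℂ) : ℝ :=
  limUnder atTop fun n : ℕ => renyiEoP α (bipartitePow n ρ) / (n : ℝ)

/-- An ensemble `{p(x), ρ_x}` of mixed states on the system `A`, with finite alphabet `X`. -/
structure Ensemble (A X : Type*) [Fintype A] [Fintype X] where
  prob : X → ℝ
  state : X → Matrix A A ℂ
  prob_nonneg : ∀ x, 0 ≤ prob x
  prob_sum : ∑ x, prob x = 1
  state_density : ∀ x, IsDensity (state x)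

namespace Ensemble

variable {A X : Type*} [Fintype A] [Fintype X]

/-- The classical-quantum source state `ρ^{AR} = ∑ₓ p(x) ρ_x ⊗ |x⟩⟨x|`. -/
def sourceState [DecidableEq X] (S : Ensemble A X) : Matrix (A × X) (A × X) ℂ :=
  ∑ x : X, (S.prob x : ℂ) • (S.state x ⊗ₖ Matrix.single x x (1 : ℂ))

/-- The probability `p(x^n) = ∏ᵢ p(x_i)`. -/
def probPow (S : Ensemble A X) {n : ℕ} (x : Fin n → X) : ℝ :=
  ∏ i : Fin n, S.prob (x i)

/-- The state `ρ_{x^n} = ρ_{x_1} ⊗ ⋯ ⊗ ρ_{x_n}` on `A^n`. -/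
def statePow (S : Ensemble A X) {n : ℕ} (x : Fin n → X) :
    Matrix (Fin n → A) (Fin n → A) ℂ :=
  Matrix.of fun a b => ∏ i : Fin n, S.state (x i) (a i) (b i)

end Ensemble

/-- A visible compression scheme of block length `n` with compressed system `M`: the encoder is a
channel acting on `A^n` and on the side information `C^n`, where `C` has the orthonormal basis
`|x⟩`, and the decoder is a channel from `M` to `A^n`. -/
structure VisibleCode (A X : Type*) [Fintype A] [Fintype X] (n : ℕ) (M : Type*) [Fintype M] where
  encoder : Matrix ((Fin n → A) × (Fin n → X)) ((Fin n → A) × (Fin n → X)) ℂ →ₗ[ℂ] Matrix M M ℂ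
  decoder : Matrix M M ℂ →ₗ[ℂ] Matrix (Fin n → A) (Fin n → A) ℂ
  encoder_cptp : IsCPTP encoder
  decoder_cptp : IsCPTP decoder

namespace VisibleCode

variable {A X : Type*} [Fintype A] [Fintype X] {n : ℕ} {M : Type*} [Fintype M]

/-- The compression rate `(1/n) log₂ |M|`. -/
def rate (_code : VisibleCode A X n M) : ℝ :=
  1 / (n : ℝ) * Real.logb 2 (Fintype.card M)

/-- The decoded state `ξ_{x^n} = 𝒟(𝒞(ρ_{x^n} ⊗ |x^n⟩⟨x^n|))`. -/
def output [DecidableEq X] (code : VisibleCode A X n M) (S : Ensemble A X) (x : Fin n → X) :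
    Matrix (Fin n → A) (Fin n → A) ℂ :=
  code.decoder (code.encoder (S.statePow x ⊗ₖ Matrix.single x x (1 : ℂ)))

/-- The average fidelity `∑_{x^n} p(x^n) F(ρ_{x^n}, ξ_{x^n})`. -/
def averageFidelity [DecidableEq A] [DecidableEq X] (code : VisibleCode A X n M)
    (S : Ensemble A X) : ℝ :=
  ∑ x : Fin n → X, S.probPow x * fidelity (S.statePow x) (code.output S x)

end VisibleCode

end VisibleCompression

end

/-!
For a source state `∑ p(x) ρ_x ⊗ |x⟩⟨x|`, write `E_α` for its Rényi entanglement of purification.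

The sequence `E_α(A^n : R^n)` is subadditive: by Stinespring dilation (`IsCPTP.exists_isometry`)
the infimum may be taken over purifications on `A ⊗ (E ⊗ F) ⊗ R` with the partial trace over `F` as
the only channel (`renyiEoP_eq_sInf`), tensor products of such purifications are of the same form,
and the Rényi entropy is additive. Since entropies are nonnegative, Fekete's lemma gives the limit,
and the limit is at most `E_α(A^n : R^n) / n` for every `n ≥ 1`. It therefore suffices to bound
a single use of an arbitrary source, to be applied to the source of `n`-letter blocks, by
`2 ^ (-(α - 1) / (2α) * (E_α - log |M|))`.

For this bound (`Ensemble.sum_fidelity_le`) let `V : M → A ⊗ W` be the isometry dilating the decoder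
and `σ_x` the encoded states. Then `V σ_x V†` extends the decoded state `ξ_x`, and by Uhlmann's
theorem there is an extension `ω_x` of `ρ_x` with `F(ρ_x, ξ_x) ≤ √(Tr V† ω_x V)`
(`exists_extension_fidelity_le`). Averaging, concavity of the square root bounds the mean fidelity by
`√(Tr V† ν V)` with `ν = ∑ p(x) ω_x`. As `V V†` is a projection of rank `|M|`, Hölder's inequality
(`trace_compression_le`) gives `Tr V† ν V ≤ (Tr ν^α)^(1/α) |M|^((α-1)/α)`, where `Tr ν^α` is
`2 ^ ((1 - α) S_α(ν))`. Finally `E_α ≤ S_α(ν)`, because every such average of extensions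
is the output of a channel on a suitable purification (`Ensemble.renyiEoP_sourceState_le`).
-/

namespace VisibleCompression

/-! ### Spectral functions, Rényi entropies and Hölder's inequality -/

section Spectral

open scoped MatrixOrder in
lemma exists_eq_conjTranspose_mul_self {A : Type*} [Fintype A] {ρ : Matrix A A ℂ}
    (hρ : ρ.PosSemidef) : ∃ L : Matrix A A ℂ, ρ = L.conjTranspose * L := by
  classical
  obtain ⟨L, hL⟩ := CStarAlgebra.nonneg_iff_eq_star_mul_self.mp hρ.nonneg
  exact ⟨L, hL⟩

lemma exists_eq_mul_conjTranspose {A : Type*} [Fintype A] {ρ : Matrix A A ℂ}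
    (hρ : ρ.PosSemidef) : ∃ L : Matrix A A ℂ, ρ = L * L.conjTranspose := by
  obtain ⟨L, hL⟩ := exists_eq_conjTranspose_mul_self hρ
  exact ⟨L.conjTranspose, by simpa using hL⟩

lemma posSemidef_single {A : Type*} [DecidableEq A] (x : A) :
    (Matrix.single x x (1 : ℂ)).PosSemidef := by
  rw [← Matrix.diagonal_single]
  refine Matrix.PosSemidef.diagonal fun i => ?_
  by_cases h : i = x <;> simp [h]

variable {A B : Type*} [Fintype A] [DecidableEq A] [Fintype B] [DecidableEq B]

lemma trace_cfc {ρ : Matrix A A ℂ} (hρ : ρ.IsHermitian) (f : ℝ → ℝ) :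
    (cfc f ρ).trace = ∑ i, (f (hρ.eigenvalues i) : ℂ) := by
  rw [hρ.cfc_eq f, Matrix.IsHermitian.cfc, Unitary.conjStarAlgAut_apply, Matrix.trace_mul_comm,
    ← mul_assoc]
  simp [Matrix.trace]

lemma trace_cfc_re {ρ : Matrix A A ℂ} (hρ : ρ.IsHermitian) (f : ℝ → ℝ) :
    (cfc f ρ).trace.re = ∑ i, f (hρ.eigenvalues i) := by
  simp [trace_cfc hρ f]

/-- The trace of a function of a Hermitian matrix can be computed from any factorization of the
characteristic polynomial, whatever the index set of the roots. -/
lemma trace_cfc_re_of_charpoly {ι : Type*} [Fintype ι] {ρ : Matrix A A ℂ} (hρ : ρ.IsHermitian)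
    (d : ι → ℝ) (hd : ρ.charpoly = ∏ i, (Polynomial.X - Polynomial.C (d i : ℂ))) (f : ℝ → ℝ) :
    (cfc f ρ).trace.re = ∑ i, f (d i) := by
  have h1 := hρ.roots_charpoly_eq_eigenvalues
  have h2 : ρ.charpoly.roots = Multiset.map (fun i => (d i : ℂ)) Finset.univ.val := by
    rw [hd, Polynomial.roots_prod _ _ (by
      rw [Finset.prod_ne_zero_iff]; exact fun i _ => Polynomial.X_sub_C_ne_zero _)]
    simp
  rw [h2] at h1
  have h3 := congrArg (fun s : Multiset ℂ => (s.map (fun z => f z.re)).sum) h1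
  simp only [Multiset.map_map, Function.comp_def, Complex.ofReal_re] at h3
  rw [trace_cfc_re hρ]
  simpa using h3.symm

lemma trace_cfc_re_submatrix {ρ : Matrix A A ℂ} (hρ : ρ.IsHermitian) (e : B ≃ A) (f : ℝ → ℝ) :
    (cfc f (ρ.submatrix e e)).trace.re = (cfc f ρ).trace.re := by
  rw [trace_cfc_re hρ]
  refine trace_cfc_re_of_charpoly (hρ.submatrix e) _ ?_ f
  have := Matrix.charpoly_reindex e.symm ρ
  rw [Matrix.reindex_apply] at this
  simpa [hρ.charpoly_eq] using this

lemma charpoly_kronecker {ρ : Matrix A A ℂ} {σ : Matrix B B ℂ} (hρ : ρ.IsHermitian)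
    (hσ : σ.IsHermitian) : (ρ ⊗ₖ σ).charpoly = ∏ i : A × B, (Polynomial.X -
      Polynomial.C ((hρ.eigenvalues i.1 * hσ.eigenvalues i.2 : ℝ) : ℂ)) := by
  have h1 := hρ.spectral_theorem
  have h2 := hσ.spectral_theorem
  rw [Unitary.conjStarAlgAut_apply] at h1 h2
  conv_lhs => rw [h1, h2, Matrix.mul_kronecker_mul, Matrix.charpoly_mul_comm,
    ← Matrix.mul_kronecker_mul, ← mul_assoc, ← mul_assoc]
  simp [Matrix.diagonal_kronecker_diagonal, Matrix.charpoly_diagonal]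

lemma trace_rpow_kronecker {ρ : Matrix A A ℂ} {σ : Matrix B B ℂ} (hρ : ρ.PosSemidef)
    (hσ : σ.PosSemidef) (α : ℝ) :
    (cfc (fun x : ℝ => x ^ α) (ρ ⊗ₖ σ)).trace.re =
      (cfc (fun x : ℝ => x ^ α) ρ).trace.re * (cfc (fun x : ℝ => x ^ α) σ).trace.re := by
  rw [trace_cfc_re_of_charpoly (hρ.kronecker hσ).1 _ (charpoly_kronecker hρ.1 hσ.1),
    trace_cfc_re hρ.1, trace_cfc_re hσ.1, Fintype.sum_prod_type, Finset.sum_mul_sum]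
  refine Finset.sum_congr rfl fun i _ => Finset.sum_congr rfl fun j _ => ?_
  exact Real.mul_rpow (hρ.eigenvalues_nonneg i) (hσ.eigenvalues_nonneg j)

lemma IsDensity.sum_eigenvalues {ρ : Matrix A A ℂ} (hρ : IsDensity ρ) :
    ∑ i, hρ.1.1.eigenvalues i = 1 := by
  have := hρ.1.1.trace_eq_sum_eigenvalues
  simpa using (congrArg Complex.re (this.symm.trans hρ.2))

lemma IsDensity.trace_rpow_pos {ρ : Matrix A A ℂ} (hρ : IsDensity ρ) (α : ℝ) :
    0 < (cfc (fun x : ℝ => x ^ α) ρ).trace.re := by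
  rw [trace_cfc_re hρ.1.1]
  have h0 := hρ.1.eigenvalues_nonneg
  obtain ⟨i, -, hi⟩ : ∃ i ∈ Finset.univ, 0 < hρ.1.1.eigenvalues i := by
    by_contra! h
    have := Finset.sum_nonpos h
    rw [hρ.sum_eigenvalues] at this
    linarith
  exact Finset.sum_pos' (fun j _ => Real.rpow_nonneg (h0 j) _)
    ⟨i, Finset.mem_univ _, Real.rpow_pos_of_pos hi _⟩

lemma IsDensity.trace_rpow_le_one {ρ : Matrix A A ℂ} (hρ : IsDensity ρ) {α : ℝ} (hα : 1 < α) :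
    (cfc (fun x : ℝ => x ^ α) ρ).trace.re ≤ 1 := by
  rw [trace_cfc_re hρ.1.1, ← hρ.sum_eigenvalues]
  have h0 := hρ.1.eigenvalues_nonneg
  refine Finset.sum_le_sum fun i _ => ?_
  have h1 : hρ.1.1.eigenvalues i ≤ 1 :=
    hρ.sum_eigenvalues ▸ Finset.single_le_sum (fun j _ => h0 j) (Finset.mem_univ i)
  simpa using Real.rpow_le_rpow_of_exponent_ge' (h0 i) h1 zero_le_one hα.le

lemma IsDensity.renyiEntropy_nonneg {ρ : Matrix A A ℂ} (hρ : IsDensity ρ) {α : ℝ} (hα : 1 < α) :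
    0 ≤ renyiEntropy α ρ := by
  refine mul_nonneg_of_nonpos_of_nonpos ?_ (Real.logb_nonpos one_lt_two
    (hρ.trace_rpow_pos α).le (hρ.trace_rpow_le_one hα))
  exact div_nonpos_of_nonneg_of_nonpos zero_le_one (by linarith)

lemma renyiEntropy_submatrix {ρ : Matrix A A ℂ} (hρ : ρ.IsHermitian) (e : B ≃ A) (α : ℝ) :
    renyiEntropy α (ρ.submatrix e e) = renyiEntropy α ρ := by
  rw [renyiEntropy, renyiEntropy, trace_cfc_re_submatrix hρ]

lemma IsDensity.renyiEntropy_kronecker {ρ : Matrix A A ℂ} {σ : Matrix B B ℂ} (hρ : IsDensity ρ)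
    (hσ : IsDensity σ) (α : ℝ) :
    renyiEntropy α (ρ ⊗ₖ σ) = renyiEntropy α ρ + renyiEntropy α σ := by
  rw [renyiEntropy, trace_rpow_kronecker hρ.1 hσ.1, Real.logb_mul (hρ.trace_rpow_pos α).ne'
    (hσ.trace_rpow_pos α).ne', mul_add]
  rfl

lemma IsDensity.trace_rpow_eq {ρ : Matrix A A ℂ} (hρ : IsDensity ρ) {α : ℝ} (hα : 1 < α) :
    (cfc (fun x : ℝ => x ^ α) ρ).trace.re = 2 ^ ((1 - α) * renyiEntropy α ρ) := by
  have h : (1 - α) * renyiEntropy α ρ = Real.logb 2 (cfc (fun x : ℝ => x ^ α) ρ).trace.re := by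
    have : 1 - α ≠ 0 := by linarith
    rw [renyiEntropy]; field_simp
  rw [h, Real.rpow_logb two_pos (by norm_num) (hρ.trace_rpow_pos α)]

end Spectral

section Holder

variable {A M : Type*} [Fintype A] [Fintype M] [DecidableEq M]

/-- The squared length of the image of a unit vector under the adjoint of an isometry is at
most one. -/
lemma sum_normSq_row_le_one {V : Matrix A M ℂ} (hV : V.conjTranspose * V = 1) (i : A) :
    ∑ m, ‖V i m‖ ^ 2 ≤ 1 := by
  -- `c = (V V†)ᵢᵢ` for the projection `V V†`, so that `c² ≤ ∑ⱼ |(V V†)ᵢⱼ|² = c`.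
  set P := V * V.conjTranspose with hP
  have hPP : P * P.conjTranspose = P := by
    rw [hP, Matrix.conjTranspose_mul, Matrix.conjTranspose_conjTranspose, Matrix.mul_assoc,
      ← Matrix.mul_assoc _ V, hV, Matrix.one_mul]
  have hc : P i i = ((∑ m, ‖V i m‖ ^ 2 : ℝ) : ℂ) := by
    simp [hP, Matrix.mul_apply, Complex.mul_conj, Complex.normSq_eq_norm_sq]
  have hs : P i i = ((∑ j, ‖P i j‖ ^ 2 : ℝ) : ℂ) := by
    conv_lhs => rw [← hPP]
    simp [Matrix.mul_apply, Complex.mul_conj, Complex.normSq_eq_norm_sq]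
  set c := ∑ m, ‖V i m‖ ^ 2
  have h1 : c = ∑ j, ‖P i j‖ ^ 2 := by
    rw [hc] at hs; exact_mod_cast hs
  have h2 : c ^ 2 ≤ c := by
    have := Finset.single_le_sum (f := fun j => ‖P i j‖ ^ 2) (fun j _ => by positivity)
      (Finset.mem_univ i)
    rw [← h1, hc, Complex.norm_real, Real.norm_eq_abs, sq_abs] at this
    exact this
  nlinarith

/-- Hölder's inequality between `ω` in the Schatten `α`-norm and the projection on the range of an
isometry `V`, which has rank `|M|`. -/
lemma trace_compression_le [DecidableEq A] {ω : Matrix A A ℂ} (hω : ω.PosSemidef) {V : Matrix A M ℂ}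
    (hV : V.conjTranspose * V = 1) {α : ℝ} (hα : 1 < α) :
    (V.conjTranspose * ω * V).trace.re ≤
      (cfc (fun x : ℝ => x ^ α) ω).trace.re ^ (1 / α) *
        (Fintype.card M : ℝ) ^ ((α - 1) / α) := by
  -- In an eigenbasis of `ω` the isometry becomes `W` and the trace becomes `∑ λᵢ cᵢ`.
  set U : Matrix A A ℂ := (hω.1.eigenvectorUnitary : Matrix A A ℂ) with hU
  have hUU : U * star U = 1 := Unitary.coe_mul_star_self _
  set W := star U * V with hW
  have hWs : W.conjTranspose = V.conjTranspose * U := by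
    rw [hW, Matrix.conjTranspose_mul, Matrix.star_eq_conjTranspose U,
      Matrix.conjTranspose_conjTranspose]
  have hWW : W.conjTranspose * W = 1 := by
    rw [hWs, hW, Matrix.mul_assoc, ← Matrix.mul_assoc U, hUU, Matrix.one_mul, hV]
  set l := hω.1.eigenvalues
  set c : A → ℝ := fun i => ∑ m, ‖W i m‖ ^ 2 with hc
  have hl := hω.eigenvalues_nonneg
  have hc0 : ∀ i, 0 ≤ c i := fun i => Finset.sum_nonneg fun m _ => by positivity
  have hc1 : ∀ i, c i ≤ 1 := sum_normSq_row_le_one hWW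
  have hcs : ∑ i, c i = Fintype.card M := by
    have := congrArg (fun T => (Matrix.trace T).re) hWW
    simp only [Matrix.trace_one, Complex.natCast_re] at this
    rw [← this, hc, Finset.sum_comm]
    simp [Matrix.trace, Matrix.mul_apply, Complex.conj_mul', ← Complex.ofReal_pow]
  have hspec : ω = U * Matrix.diagonal (fun i => (l i : ℂ)) * star U := by
    have := hω.1.spectral_theorem
    rwa [Unitary.conjStarAlgAut_apply] at this
  have htr : (V.conjTranspose * ω * V).trace.re = ∑ i, l i * c i := by
    have h1 : V.conjTranspose * ω * V =
        W.conjTranspose * Matrix.diagonal (fun i => (l i : ℂ)) * W := by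
      rw [hWs, hW]
      conv_lhs => rw [hspec]
      simp only [Matrix.mul_assoc]
    rw [h1, Matrix.trace_mul_comm, ← Matrix.mul_assoc, Matrix.trace_mul_comm]
    rw [Matrix.trace, Complex.re_sum]
    refine Finset.sum_congr rfl fun i _ => ?_
    have : (W * W.conjTranspose) i i = ((c i : ℝ) : ℂ) := by
      simp [hc, Matrix.mul_apply, Complex.mul_conj, Complex.normSq_eq_norm_sq]
    rw [Matrix.diag_apply, Matrix.diagonal_mul, this, ← Complex.ofReal_mul, Complex.ofReal_re]
  have hpq : α.HolderConjugate (α / (α - 1)) := Real.HolderConjugate.conjExponent hα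
  rw [htr, trace_cfc_re hω.1]
  refine (Real.inner_le_Lp_mul_Lq_of_nonneg Finset.univ hpq (fun i _ => hl i)
    (fun i _ => hc0 i)).trans ?_
  refine mul_le_mul_of_nonneg_left ?_ (Real.rpow_nonneg
    (Finset.sum_nonneg fun i _ => Real.rpow_nonneg (hl i) _) _)
  rw [one_div_div]
  refine Real.rpow_le_rpow (Finset.sum_nonneg fun i _ => Real.rpow_nonneg (hc0 i) _) ?_
    (div_nonneg (by linarith) (by linarith))
  rw [← hcs]
  refine Finset.sum_le_sum fun i _ => ?_
  have : 1 ≤ α / (α - 1) := by rw [le_div_iff₀ (by linarith)]; linarith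
  simpa using Real.rpow_le_rpow_of_exponent_ge' (hc0 i) (hc1 i) zero_le_one this

end Holder

/-! ### Channels, partial traces and Stinespring dilation -/

section Channels

/-- The partial trace over the second factor `F` of a joint system `E ⊗ F`. -/
def traceRight (E F : Type*) [Fintype F] : Matrix (E × F) (E × F) ℂ →ₗ[ℂ] Matrix E E ℂ where
  toFun T := Matrix.of fun i j => ∑ f, T (i, f) (j, f)
  map_add' S T := by ext; simp [Finset.sum_add_distrib]
  map_smul' c T := by ext; simp [Finset.mul_sum]

lemma traceRight_apply {E F : Type*} [Fintype F] (T : Matrix (E × F) (E × F) ℂ) (i j : E) :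
    traceRight E F T i j = ∑ f, T (i, f) (j, f) := rfl

lemma posSemidef_traceRight {E F : Type*} [Finite E] [Fintype F] {T : Matrix (E × F) (E × F) ℂ}
    (hT : T.PosSemidef) : (traceRight E F T).PosSemidef := by
  have : traceRight E F T = ∑ f, T.submatrix (fun i => (i, f)) (fun i => (i, f)) := by
    ext i j; simp [traceRight_apply, Matrix.sum_apply]
  rw [this]
  exact Matrix.posSemidef_sum _ fun f _ => hT.submatrix _

lemma trace_traceRight {E F : Type*} [Fintype E] [Fintype F] (T : Matrix (E × F) (E × F) ℂ) :
    (traceRight E F T).trace = T.trace := by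
  simp [Matrix.trace, traceRight_apply, Fintype.sum_prod_type]

lemma isCPTP_traceRight (E F : Type*) [Fintype E] [Fintype F] : IsCPTP (traceRight E F) where
  completelyPositive k T hT := by
    have := posSemidef_traceRight (hT.submatrix (Equiv.prodAssoc (Fin k) E F))
    convert this using 1
    rfl
  tracePreserving := trace_traceRight

/-- Stinespring dilation: a channel is an isometry into a larger system followed by a partial
trace. The isometry is read off from a factorization of the Choi matrix. -/
lemma IsCPTP.exists_isometry {B E : Type*} [Fintype B] [DecidableEq B] [Fintype E]
    {N : Matrix B B ℂ →ₗ[ℂ] Matrix E E ℂ} (hN : IsCPTP N) :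
    ∃ V : Matrix (E × (Fin (Fintype.card B) × E)) B ℂ, V.conjTranspose * V = 1 ∧
      ∀ T, N T = traceRight E _ (V * T * V.conjTranspose) := by
  let e := Fintype.equivFin B
  let v : Fin (Fintype.card B) × B → ℂ := fun i => if e.symm i.1 = i.2 then 1 else 0
  -- The Choi matrix: `N` applied to half of the unnormalized maximally entangled vector `v`.
  obtain ⟨L, hL⟩ := exists_eq_conjTranspose_mul_self
    (hN.completelyPositive _ _ (Matrix.posSemidef_vecMulVec_self_star v))
  have hchoi : ∀ i j, N (Matrix.single i j 1) = Matrix.of fun a b =>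
      ∑ w, star (L w (e i, a)) * L w (e j, b) := by
    intro i j
    ext a b
    have h := congrFun (congrFun hL (e i, a)) (e j, b)
    have h1 : (Matrix.of fun k l => Matrix.vecMulVec v (star v) (e i, k) (e j, l)) =
        Matrix.single i j (1 : ℂ) := by
      ext k l
      simp only [Matrix.of_apply, Matrix.vecMulVec_apply, v, Pi.star_apply, e.symm_apply_apply,
        Matrix.single_apply]
      split_ifs <;> simp_all
    simp only [idTensor, Matrix.of_apply, h1] at h
    rw [h, Matrix.mul_apply]
    rfl
  let V : Matrix (E × (Fin (Fintype.card B) × E)) B ℂ :=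
    Matrix.of fun a i => star (L a.2 (e i, a.1))
  have hV : ∀ T, N T = traceRight E _ (V * T * V.conjTranspose) := by
    intro T
    ext a b
    conv_lhs => rw [Matrix.matrix_eq_sum_single T]
    have h1 : ∀ i j, N (Matrix.single i j (T i j)) = T i j • N (Matrix.single i j 1) := by
      intro i j
      rw [← map_smul, Matrix.smul_single, smul_eq_mul, mul_one]
    simp only [map_sum, h1, hchoi, Matrix.sum_apply, Matrix.smul_apply, Matrix.of_apply,
      smul_eq_mul, traceRight_apply, Matrix.mul_apply, Matrix.conjTranspose_apply, V, star_star,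
      Finset.mul_sum, Finset.sum_mul]
    rw [Finset.sum_comm_cycle]
    refine Finset.sum_congr rfl fun w _ => ?_
    rw [Finset.sum_comm]
    exact Finset.sum_congr rfl fun i _ => Finset.sum_congr rfl fun j _ => by ring
  refine ⟨V, ?_, hV⟩
  ext j i
  have h := hN.tracePreserving (Matrix.single i j 1)
  rw [hchoi] at h
  have h2 : (V.conjTranspose * V) j i = (Matrix.single i j (1 : ℂ)).trace := by
    rw [← h]
    simp only [Matrix.trace, Matrix.diag_apply, Matrix.of_apply, Matrix.mul_apply,
      Matrix.conjTranspose_apply, V, star_star, Fintype.sum_prod_type]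
    exact Finset.sum_congr rfl fun a _ => Finset.sum_congr rfl fun k _ =>
      Finset.sum_congr rfl fun b _ => mul_comm _ _
  rw [h2, Matrix.one_apply]
  split_ifs with hij
  · rw [hij, Matrix.trace_single_eq_same]
  · exact Matrix.trace_single_eq_of_ne _ _ _ (Ne.symm hij)

lemma IsCPTP.isDensity {B E : Type*} [Fintype B] [Fintype E]
    {N : Matrix B B ℂ →ₗ[ℂ] Matrix E E ℂ} (hN : IsCPTP N) {ρ : Matrix B B ℂ} (hρ : IsDensity ρ) :
    IsDensity (N ρ) := by
  classical
  obtain ⟨V, -, hV⟩ := hN.exists_isometry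
  exact ⟨hV ρ ▸ posSemidef_traceRight (hρ.1.mul_mul_conjTranspose_same V),
    (hN.tracePreserving ρ).trans hρ.2⟩

end Channels

/-! ### Purifications and subadditivity -/

section Purifications

/-- The marginal on `A ⊗ E` of a pure vector `ψ` on `A ⊗ (E ⊗ F) ⊗ R`. By Stinespring dilation,
these are all the states over which the Rényi entanglement of purification is minimized. -/
def pureMarginal {A E F R : Type*} [Fintype F] [Fintype R] (ψ : A × (E × F) × R → ℂ) :
    Matrix (A × E) (A × E) ℂ :=
  idTensor (traceRight E F) (traceLast (ketBra ψ))

lemma pureMarginal_apply {A E F R : Type*} [Fintype F] [Fintype R] (ψ : A × (E × F) × R → ℂ)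
    (i j : A × E) :
    pureMarginal ψ i j = ∑ f, ∑ r, ψ (i.1, (i.2, f), r) * conj (ψ (j.1, (j.2, f), r)) := rfl

/-- The set of entropies of the marginals on `A ⊗ E` of the purifications of `ρ`. -/
def marginalEntropies {A R : Type u} [Fintype A] [DecidableEq A] [Fintype R] (α : ℝ)
    (ρ : Matrix (A × R) (A × R) ℂ) : Set ℝ :=
  {s | ∃ (E F : Type u) (_ : Fintype E) (_ : Fintype F) (_ : DecidableEq E)
    (ψ : A × (E × F) × R → ℂ), IsPurification ψ ρ ∧ s = renyiEntropy α (pureMarginal ψ)}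

lemma isPurification_iff {A B R : Type*} [Fintype B] {ψ : A × B × R → ℂ}
    {ρ : Matrix (A × R) (A × R) ℂ} : IsPurification ψ ρ ↔
      ∀ a r a' r', ∑ b, ψ (a, b, r) * conj (ψ (a', b, r')) = ρ (a, r) (a', r') := by
  rw [IsPurification, ← Matrix.ext_iff]
  simp only [Prod.forall]
  rfl

/-- Applying an isometry to the purifying system gives another purification, and the marginal left
after a partial trace is the output of the channel that the isometry dilates. -/
lemma exists_pureMarginal_eq {A B E R : Type*} [Fintype B] [Fintype E] [Fintype R]
    {ρ : Matrix (A × R) (A × R) ℂ} {ψ : A × B × R → ℂ} (hψ : IsPurification ψ ρ)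
    {N : Matrix B B ℂ →ₗ[ℂ] Matrix E E ℂ} (hN : IsCPTP N) :
    ∃ φ : A × (E × (Fin (Fintype.card B) × E)) × R → ℂ, IsPurification φ ρ ∧
      pureMarginal φ = idTensor N (traceLast (ketBra ψ)) := by
  classical
  obtain ⟨V, hV, hNV⟩ := hN.exists_isometry
  refine ⟨fun i => ∑ b, V i.2.1 b * ψ (i.1, b, i.2.2), ?_, ?_⟩
  · rw [isPurification_iff] at hψ ⊢
    intro a r a' r'
    rw [← hψ a r a' r']
    have h : ∀ c b, ∑ w, V w b * conj (V w c) = if c = b then 1 else 0 := by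
      intro c b
      have := congrFun (congrFun hV c) b
      rw [Matrix.mul_apply, Matrix.one_apply] at this
      rw [← this]
      exact Finset.sum_congr rfl fun w _ => mul_comm _ _
    simp only [map_sum, map_mul, Finset.sum_mul_sum]
    rw [Finset.sum_comm]
    refine Finset.sum_congr rfl fun b _ => ?_
    rw [Finset.sum_comm]
    calc ∑ c, ∑ w, V w b * ψ (a, b, r) * (conj (V w c) * conj (ψ (a', c, r')))
        = ∑ c, (∑ w, V w b * conj (V w c)) * (ψ (a, b, r) * conj (ψ (a', c, r'))) := by
          refine Finset.sum_congr rfl fun c _ => ?_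
          rw [Finset.sum_mul]
          exact Finset.sum_congr rfl fun w _ => by ring
      _ = _ := by simp [h]
  · ext i j
    rw [pureMarginal_apply]
    simp only [idTensor, Matrix.of_apply, hNV, traceRight_apply]
    refine Finset.sum_congr rfl fun w _ => ?_
    simp only [Matrix.mul_apply, Matrix.of_apply, traceLast, ketBra, Matrix.conjTranspose_apply,
      map_sum, map_mul, Finset.sum_mul, Finset.mul_sum]
    rw [Finset.sum_comm]
    refine (Finset.sum_congr rfl fun b _ => ?_)
    rw [Finset.sum_comm]
    refine Finset.sum_congr rfl fun c _ => Finset.sum_congr rfl fun r _ => ?_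
    simp only [RCLike.star_def]
    ring

lemma renyiEoP_eq_sInf {A R : Type u} [Fintype A] [DecidableEq A] [Fintype R]
    (α : ℝ) (ρ : Matrix (A × R) (A × R) ℂ) :
    renyiEoP α ρ = sInf (marginalEntropies α ρ) := by
  rw [renyiEoP]
  congr 1
  ext s
  constructor
  · rintro ⟨B, E, _, _, _, ψ, N, hψ, hN, rfl⟩
    obtain ⟨φ, hφ, h⟩ := exists_pureMarginal_eq hψ hN
    exact ⟨E, _, _, inferInstance, _, φ, hφ, by rw [h]⟩
  · rintro ⟨E, F, _, _, _, ψ, hψ, rfl⟩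
    exact ⟨E × F, E, inferInstance, _, _, ψ, traceRight E F, hψ, isCPTP_traceRight E F, rfl⟩

lemma IsPurification.isDensity_pureMarginal {A E F R : Type*} [Fintype A] [Fintype E] [Fintype F]
    [Fintype R] {ρ : Matrix (A × R) (A × R) ℂ} (hρ : IsDensity ρ) {ψ : A × (E × F) × R → ℂ}
    (hψ : IsPurification ψ ρ) : IsDensity (pureMarginal ψ) := by
  constructor
  · have : pureMarginal ψ = ∑ f, ∑ r, Matrix.vecMulVec (fun i : A × E => ψ (i.1, (i.2, f), r))
        (star fun i : A × E => ψ (i.1, (i.2, f), r)) := by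
      ext i j
      simp only [pureMarginal_apply, Matrix.sum_apply]
      rfl
    rw [this]
    exact Matrix.posSemidef_sum _ fun f _ => Matrix.posSemidef_sum _ fun r _ =>
      Matrix.posSemidef_vecMulVec_self_star _
  · rw [← hρ.2]
    rw [isPurification_iff] at hψ
    simp only [Matrix.trace, Matrix.diag_apply, pureMarginal_apply, Fintype.sum_prod_type, ← hψ]
    refine Finset.sum_congr rfl fun a _ => ?_
    rw [Finset.sum_comm_cycle]

lemma marginalEntropies_nonneg {A R : Type u} [Fintype A] [DecidableEq A] [Fintype R]
    {ρ : Matrix (A × R) (A × R) ℂ} (hρ : IsDensity ρ) {α : ℝ} (hα : 1 < α) {s : ℝ}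
    (hs : s ∈ marginalEntropies α ρ) : 0 ≤ s := by
  obtain ⟨E, F, _, _, _, ψ, hψ, rfl⟩ := hs
  exact (hψ.isDensity_pureMarginal hρ).renyiEntropy_nonneg hα

lemma bddBelow_marginalEntropies {A R : Type u} [Fintype A] [DecidableEq A] [Fintype R]
    {ρ : Matrix (A × R) (A × R) ℂ} (hρ : IsDensity ρ) {α : ℝ} (hα : 1 < α) :
    BddBelow (marginalEntropies α ρ) :=
  ⟨0, fun _ hs => marginalEntropies_nonneg hρ hα hs⟩

lemma renyiEoP_nonneg {A R : Type u} [Fintype A] [DecidableEq A] [Fintype R]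
    {ρ : Matrix (A × R) (A × R) ℂ} (hρ : IsDensity ρ) {α : ℝ} (hα : 1 < α) :
    0 ≤ renyiEoP α ρ := by
  rw [renyiEoP_eq_sInf]
  exact Real.sInf_nonneg fun _ hs => marginalEntropies_nonneg hρ hα hs

lemma marginalEntropies_nonempty {A R : Type u} [Fintype A] [DecidableEq A] [Fintype R]
    {ρ : Matrix (A × R) (A × R) ℂ} (hρ : IsDensity ρ) (α : ℝ) :
    (marginalEntropies α ρ).Nonempty := by
  obtain ⟨L, hL⟩ := exists_eq_mul_conjTranspose hρ.1
  refine ⟨_, PUnit, A × R, inferInstance, inferInstance, inferInstance,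
    fun i => L (i.1, i.2.2) i.2.1.2, ?_, rfl⟩
  rw [isPurification_iff]
  intro a r a' r'
  rw [hL, Matrix.mul_apply, Fintype.sum_prod_type]
  simp [Matrix.conjTranspose_apply]

/-- The tensor product of purifications of `ρ` and `σ` purifies `ρ ⊗ σ`, so the infimum is
subadditive. -/
lemma renyiEoP_le_add {A₁ A₂ A R₁ R₂ R : Type u} [Fintype A₁] [DecidableEq A₁] [Fintype A₂]
    [DecidableEq A₂] [Fintype A] [DecidableEq A] [Fintype R₁] [Fintype R₂] [Fintype R]
    {ρ : Matrix (A₁ × R₁) (A₁ × R₁) ℂ} {σ : Matrix (A₂ × R₂) (A₂ × R₂) ℂ}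
    {τ : Matrix (A × R) (A × R) ℂ} (hρ : IsDensity ρ) (hσ : IsDensity σ) (hτ : IsDensity τ)
    (e : A ≃ A₁ × A₂) (f : R ≃ R₁ × R₂)
    (h : ∀ a r a' r', τ (a, r) (a', r') =
      ρ ((e a).1, (f r).1) ((e a').1, (f r').1) * σ ((e a).2, (f r).2) ((e a').2, (f r').2))
    {α : ℝ} (hα : 1 < α) :
    renyiEoP α τ ≤ renyiEoP α ρ + renyiEoP α σ := by
  simp only [renyiEoP_eq_sInf]
  rw [← csInf_add (marginalEntropies_nonempty hρ α) (bddBelow_marginalEntropies hρ hα)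
    (marginalEntropies_nonempty hσ α) (bddBelow_marginalEntropies hσ hα)]
  refine csInf_le_csInf (bddBelow_marginalEntropies hτ hα)
    ((marginalEntropies_nonempty hρ α).add (marginalEntropies_nonempty hσ α)) ?_
  rintro _ ⟨_, ⟨E₁, F₁, _, _, _, ψ, hψ, rfl⟩, _, ⟨E₂, F₂, _, _, _, φ, hφ, rfl⟩, rfl⟩
  let χ : A × ((E₁ × E₂) × (F₁ × F₂)) × R → ℂ := fun i =>
    ψ ((e i.1).1, (i.2.1.1.1, i.2.1.2.1), (f i.2.2).1) *
      φ ((e i.1).2, (i.2.1.1.2, i.2.1.2.2), (f i.2.2).2)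
  refine ⟨E₁ × E₂, F₁ × F₂, inferInstance, inferInstance, inferInstance, χ, ?_, ?_⟩
  · rw [isPurification_iff] at hψ hφ ⊢
    intro a r a' r'
    rw [h, ← hψ, ← hφ, Finset.sum_mul_sum, ← Fintype.sum_prod_type',
      ← (Equiv.prodProdProdComm E₁ E₂ F₁ F₂).sum_comp]
    refine Finset.sum_congr rfl fun b _ => ?_
    simp only [χ, map_mul, Equiv.prodProdProdComm_apply]
    ring
  · have h1 : pureMarginal χ = (pureMarginal ψ ⊗ₖ pureMarginal φ).submatrix
        ((e.prodCongr (Equiv.refl _)).trans (Equiv.prodProdProdComm A₁ A₂ E₁ E₂))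
        ((e.prodCongr (Equiv.refl _)).trans (Equiv.prodProdProdComm A₁ A₂ E₁ E₂)) := by
      ext i j
      simp only [Matrix.submatrix_apply, Matrix.kroneckerMap_apply, pureMarginal_apply]
      rw [Finset.sum_mul_sum, Fintype.sum_prod_type]
      refine Finset.sum_congr rfl fun g₁ _ => Finset.sum_congr rfl fun g₂ _ => ?_
      rw [Finset.sum_mul_sum, ← f.symm.sum_comp, Fintype.sum_prod_type]
      refine Finset.sum_congr rfl fun r₁ _ => Finset.sum_congr rfl fun r₂ _ => ?_
      simp only [χ, map_mul, Equiv.apply_symm_apply]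
      exact mul_mul_mul_comm _ _ _ _
    have hd1 := hψ.isDensity_pureMarginal hρ
    have hd2 := hφ.isDensity_pureMarginal hσ
    rw [h1, renyiEntropy_submatrix (hd1.1.kronecker hd2.1).1, hd1.renyiEntropy_kronecker hd2]

lemma subadditive_renyiEoP {A R : Type u} [Fintype A] [DecidableEq A] [Fintype R]
    {ρ : Matrix (A × R) (A × R) ℂ} (hρ : ∀ n, IsDensity (bipartitePow n ρ)) {α : ℝ}
    (hα : 1 < α) : Subadditive fun n => renyiEoP α (bipartitePow n ρ) := by
  intro m n
  refine renyiEoP_le_add (hρ m) (hρ n) (hρ (m + n)) (Fin.appendEquiv m n).symm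
    (Fin.appendEquiv m n).symm (fun a r a' r' => ?_) hα
  simp only [bipartitePow, Matrix.of_apply, Fin.prod_univ_add]
  rfl

end Purifications

/-! ### Classical-quantum sources -/

section Sources

lemma Ensemble.sourceState_apply {A X : Type*} [Fintype A] [Fintype X] [DecidableEq X]
    (S : Ensemble A X) (a a' : A) (x x' : X) :
    S.sourceState (a, x) (a', x') = if x = x' then (S.prob x : ℂ) * S.state x a a' else 0 := by
  simp only [sourceState, Matrix.sum_apply, Matrix.smul_apply, Matrix.kroneckerMap_apply,
    Matrix.single_apply, smul_eq_mul]
  split_ifs with h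
  · subst h
    rw [Finset.sum_eq_single x] <;> simp +contextual
  · refine Finset.sum_eq_zero fun y _ => ?_
    rw [if_neg (fun hy => h (hy.1.symm.trans hy.2))]
    simp

lemma Ensemble.isDensity_sourceState {A X : Type*} [Fintype A] [Fintype X] [DecidableEq X]
    (S : Ensemble A X) : IsDensity S.sourceState := by
  constructor
  · refine Matrix.posSemidef_sum _ fun x _ => ?_
    refine Matrix.PosSemidef.smul ?_ (by exact_mod_cast S.prob_nonneg x)
    exact (S.state_density x).1.kronecker (posSemidef_single x)
  · simp only [sourceState, Matrix.trace_sum, Matrix.trace_smul, Matrix.trace_kronecker,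
      (S.state_density _).2, Matrix.trace_single_eq_same, mul_one, smul_eq_mul]
    exact_mod_cast S.prob_sum

lemma isDensity_piTensor {A : Type*} [Fintype A] {n : ℕ}
    {ρ : Fin n → Matrix A A ℂ} (hρ : ∀ i, IsDensity (ρ i)) :
    IsDensity (Matrix.of fun a b : Fin n → A => ∏ i, ρ i (a i) (b i)) := by
  classical
  constructor
  · choose L hL using fun i => exists_eq_mul_conjTranspose (hρ i).1
    have : (Matrix.of fun a b : Fin n → A => ∏ i, ρ i (a i) (b i)) =
        (Matrix.of fun a c : Fin n → A => ∏ i, L i (a i) (c i)) *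
          (Matrix.of fun a c : Fin n → A => ∏ i, L i (a i) (c i)).conjTranspose := by
      ext a b
      simp only [Matrix.of_apply, Matrix.mul_apply, Matrix.conjTranspose_apply, RCLike.star_def,
        map_prod, ← Finset.prod_mul_distrib]
      rw [← Fintype.prod_sum fun i c => L i (a i) c * conj (L i (b i) c)]
      refine Finset.prod_congr rfl fun i _ => ?_
      rw [hL i, Matrix.mul_apply]
      rfl
    rw [this]
    exact Matrix.posSemidef_self_mul_conjTranspose _
  · simp only [Matrix.trace, Matrix.diag_apply, Matrix.of_apply]
    rw [← Fintype.prod_sum fun i a => ρ i a a]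
    exact Finset.prod_eq_one fun i _ => (hρ i).2

/-- The ensemble of the sequences of `n` independent letters of a source. -/
def Ensemble.pow {A X : Type*} [Fintype A] [Fintype X] (S : Ensemble A X) (n : ℕ) :
    Ensemble (Fin n → A) (Fin n → X) where
  prob := S.probPow
  state := S.statePow
  prob_nonneg _ := Finset.prod_nonneg fun _ _ => S.prob_nonneg _
  prob_sum := by
    classical
    simp only [probPow]
    rw [← Fintype.prod_sum fun _ x => S.prob x]
    exact Finset.prod_eq_one fun _ _ => S.prob_sum
  state_density x := isDensity_piTensor fun i => S.state_density (x i)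

lemma Ensemble.bipartitePow_sourceState {A X : Type*} [Fintype A] [Fintype X] [DecidableEq X]
    (S : Ensemble A X) (n : ℕ) : bipartitePow n S.sourceState = (S.pow n).sourceState := by
  ext ⟨a, x⟩ ⟨a', x'⟩
  simp only [bipartitePow, Matrix.of_apply, sourceState_apply, pow, probPow, statePow]
  split_ifs with h
  · subst h
    simp [Finset.prod_mul_distrib]
  · obtain ⟨k, hk⟩ := Function.ne_iff.mp h
    exact Finset.prod_eq_zero (Finset.mem_univ k) (if_neg hk)

/-- Any choice of extensions `ω x` of the signal states to `A ⊗ E` is obtained from a suitable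
purification of the source state by a channel on the purifying system: that system carries `E`,
purifying systems of the `ω x`, and a copy of the letter `x`. -/
lemma Ensemble.renyiEoP_sourceState_le {A X E : Type u} [Fintype A] [DecidableEq A] [Fintype X]
    [DecidableEq X] [Fintype E] [DecidableEq E] (S : Ensemble A X) {α : ℝ} (hα : 1 < α)
    {ω : X → Matrix (A × E) (A × E) ℂ} (hω : ∀ x, (ω x).PosSemidef)
    (hext : ∀ x, traceRight A E (ω x) = S.state x) :
    renyiEoP α S.sourceState ≤ renyiEntropy α (∑ x, (S.prob x : ℂ) • ω x) := by
  choose L hL using fun x => exists_eq_mul_conjTranspose (hω x)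
  have hL' : ∀ x i j, ω x i j = ∑ h, L x i h * conj (L x j h) := by
    intro x i j
    conv_lhs => rw [hL x]
    rfl
  have hp : ∀ x, (Real.sqrt (S.prob x) : ℂ) * Real.sqrt (S.prob x) = S.prob x := fun x => by
    rw [← Complex.ofReal_mul, Real.mul_self_sqrt (S.prob_nonneg x)]
  let ψ : A × (E × ((A × E) × X)) × X → ℂ := fun i =>
    if i.2.1.2.2 = i.2.2 then (Real.sqrt (S.prob i.2.2) : ℂ) * L i.2.2 (i.1, i.2.1.1) i.2.1.2.1
    else 0
  rw [renyiEoP_eq_sInf]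
  refine csInf_le (bddBelow_marginalEntropies S.isDensity_sourceState hα)
    ⟨E, (A × E) × X, inferInstance, inferInstance, inferInstance, ψ, ?_, ?_⟩
  · rw [isPurification_iff]
    intro a r a' r'
    rw [S.sourceState_apply, Fintype.sum_prod_type]
    simp only [Fintype.sum_prod_type (α₁ := A × E), ψ]
    by_cases h : r = r'
    · subst h
      rw [if_pos rfl, ← hext r, traceRight_apply, Finset.mul_sum]
      refine Finset.sum_congr rfl fun e _ => ?_
      rw [hL', Finset.mul_sum]
      refine Finset.sum_congr rfl fun k _ => ?_
      rw [Finset.sum_eq_single r (fun y _ hy => by simp [hy]) (by simp)]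
      simp only [if_true, map_mul, Complex.conj_ofReal]
      rw [mul_mul_mul_comm, hp]
    · rw [if_neg h]
      refine Finset.sum_eq_zero fun e _ => Finset.sum_eq_zero fun k _ =>
        Finset.sum_eq_zero fun y _ => ?_
      by_cases hy : y = r
      · rw [if_neg (c := y = r') (fun h' => h (hy.symm.trans h')), map_zero, mul_zero]
      · rw [if_neg hy, zero_mul]
  · congr 1
    ext i j
    rw [pureMarginal_apply]
    simp only [Fintype.sum_prod_type (α₁ := A × E), ψ, Matrix.sum_apply, Matrix.smul_apply,
      smul_eq_mul]
    rw [Finset.sum_comm]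
    refine Finset.sum_congr rfl fun x _ => ?_
    rw [hL', Finset.mul_sum]
    refine Finset.sum_congr rfl fun k _ => ?_
    rw [Finset.sum_eq_single x (fun y _ hy => by simp [Ne.symm hy]) (by simp)]
    simp only [if_true, map_mul, Complex.conj_ofReal]
    rw [mul_mul_mul_comm, hp]

end Sources

/-! ### The bound for a single use of a source -/

section OneShot

/-- The Cauchy–Schwarz inequality for the Hilbert–Schmidt inner product. -/
lemma re_trace_mul_conjTranspose_le {I J : Type*} [Fintype I] [Fintype J] (S T : Matrix I J ℂ) :
    (S * T.conjTranspose).trace.re ≤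
      Real.sqrt (S * S.conjTranspose).trace.re * Real.sqrt (T * T.conjTranspose).trace.re := by
  have h : ∀ S T : Matrix I J ℂ,
      (S * T.conjTranspose).trace.re = ∑ i : I × J, (S i.1 i.2 * conj (T i.1 i.2)).re := by
    intro S T
    simp [Matrix.trace, Matrix.mul_apply, Fintype.sum_prod_type]
  have h' : ∀ z : ℂ, (z * conj z).re = ‖z‖ ^ 2 := fun z => by
    rw [Complex.mul_conj, Complex.ofReal_re, Complex.normSq_eq_norm_sq]
  rw [h, h, h]
  simp only [h']
  refine (Finset.sum_le_sum fun i _ => ?_).trans (Real.sum_mul_le_sqrt_mul_sqrt Finset.univ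
    (fun i : I × J => ‖S i.1 i.2‖) fun i => ‖T i.1 i.2‖)
  refine (Complex.re_le_norm _).trans ?_
  rw [norm_mul, Complex.norm_conj]

lemma continuousOn_spectrum {A : Type*} [Fintype A] [DecidableEq A] (T : Matrix A A ℂ)
    (f : ℝ → ℝ) : ContinuousOn f (spectrum ℝ T) :=
  T.finite_real_spectrum.continuousOn f

lemma conjTranspose_cfc {A : Type*} [Fintype A] [DecidableEq A] (f : ℝ → ℝ) (T : Matrix A A ℂ) :
    (cfc f T).conjTranspose = cfc f T :=
  cfc_predicate f T

/-- The part of Uhlmann's theorem that is needed: if `V σ V†` on `A ⊗ W` extends `ξ`, some extension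
`ω` of `ρ` satisfies `F(ρ, ξ) ≤ √(Tr V† ω V)`; for an isometry `V` the right-hand side is the
amplitude of `ω` on the range of `V`. With `ξ = T T†`, the extension is built from the polar
decomposition of `T† √ρ`; the part of `ρ` that its partial isometry annihilates is added as an
incoherent term, which can only increase `Tr V† ω V`. -/
lemma exists_extension_fidelity_le {A W M : Type*} [Fintype A] [DecidableEq A] [Fintype W]
    [Nonempty W] [Fintype M] {ρ : Matrix A A ℂ} (hρ : ρ.PosSemidef)
    {σ : Matrix M M ℂ} (hσ : IsDensity σ) (V : Matrix (A × W) M ℂ) :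
    ∃ ω : Matrix (A × W) (A × W) ℂ, ω.PosSemidef ∧ traceRight A W ω = ρ ∧
      fidelity ρ (traceRight A W (V * σ * V.conjTranspose)) ≤
        Real.sqrt (V.conjTranspose * ω * V).trace.re := by
  classical
  obtain ⟨S, hS⟩ := exists_eq_mul_conjTranspose hσ.1
  let T : Matrix A (W × M) ℂ := Matrix.of fun a j => (V * S) (a, j.1) j.2
  set ξ := traceRight A W (V * σ * V.conjTranspose) with hξ
  have hT : T * T.conjTranspose = ξ := by
    have : V * σ * V.conjTranspose = (V * S) * (V * S).conjTranspose := by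
      rw [hS, Matrix.conjTranspose_mul]; simp only [Matrix.mul_assoc]
    rw [hξ, this]
    ext a b
    rw [traceRight_apply, Matrix.mul_apply, Fintype.sum_prod_type]
    rfl
  set R := cfc Real.sqrt ρ with hR
  have hRs : R.conjTranspose = R := conjTranspose_cfc _ _
  have hRR : R * R = ρ := by
    rw [hR, ← cfc_mul _ _ ρ (continuousOn_spectrum _ _) (continuousOn_spectrum _ _)]
    conv_rhs => rw [← cfc_id ℝ ρ hρ.1.isSelfAdjoint]
    refine cfc_congr fun t ht => ?_
    rw [hρ.1.spectrum_real_eq_range_eigenvalues] at ht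
    obtain ⟨i, rfl⟩ := ht
    exact Real.mul_self_sqrt (hρ.eigenvalues_nonneg i)
  set Y := T.conjTranspose * R with hY
  set H := R * ξ * R with hH
  have hYs : Y.conjTranspose = R * T := by
    rw [hY, Matrix.conjTranspose_mul, hRs, Matrix.conjTranspose_conjTranspose]
  have hYY : Y.conjTranspose * Y = H := by
    rw [hYs, hY, hH, ← hT]; simp only [Matrix.mul_assoc]
  have hHs : IsSelfAdjoint H := by
    rw [← hYY]; exact (Matrix.isHermitian_conjTranspose_mul_self Y).isSelfAdjoint
  -- `C` is the pseudo-inverse of `√H`, as `(√0)⁻¹ = 0`, and `Q` is the projection on its kernel.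
  set C := cfc (fun t : ℝ => (Real.sqrt t)⁻¹) H with hC
  set Q := cfc (fun t : ℝ => if t ≤ 0 then (1 : ℝ) else 0) H with hQ
  have hCs : C.conjTranspose = C := conjTranspose_cfc _ _
  have hQs : Q.conjTranspose = Q := conjTranspose_cfc _ _
  have hQQ : Q * Q = Q := by
    rw [hQ, ← cfc_mul _ _ H (continuousOn_spectrum _ _) (continuousOn_spectrum _ _)]
    refine cfc_congr fun t _ => ?_
    split_ifs <;> simp
  have hHC : H * C = cfc Real.sqrt H := by
    calc H * C = cfc (fun t : ℝ => t) H * C := by rw [cfc_id' ℝ H hHs]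
      _ = cfc (fun t : ℝ => t * (Real.sqrt t)⁻¹) H :=
        (cfc_mul _ _ H (continuousOn_spectrum _ _) (continuousOn_spectrum _ _)).symm
      _ = cfc Real.sqrt H := by simp only [← div_eq_mul_inv, Real.div_sqrt]
  have hCHC : C * (H * C) + Q = 1 := by
    rw [hHC, hC, hQ, ← cfc_mul _ _ H (continuousOn_spectrum _ _) (continuousOn_spectrum _ _),
      ← cfc_add _ _ _ (continuousOn_spectrum _ _) (continuousOn_spectrum _ _),
      ← cfc_one ℝ H hHs]
    refine cfc_congr fun t _ => ?_
    dsimp only [Pi.one_apply]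
    split_ifs with ht
    · rw [Real.sqrt_eq_zero_of_nonpos ht]; simp
    · rw [inv_mul_cancel₀ (Real.sqrt_ne_zero'.mpr (not_le.mp ht)), add_zero]
  set G : Matrix A (W × M) ℂ := R * (C * Y.conjTranspose) with hG
  have hGs : G.conjTranspose = Y * C * R := by
    rw [hG, Matrix.conjTranspose_mul, Matrix.conjTranspose_mul, hRs, hCs,
      Matrix.conjTranspose_conjTranspose]
  let G' : Matrix (A × W) M ℂ := Matrix.of fun i m => G i.1 (i.2, m)
  have hGG : G * G.conjTranspose = R * (C * (H * C)) * R := by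
    rw [hGs, hG, ← hYY]
    simp only [Matrix.mul_assoc]
  -- The annihilated part `K` of `ρ` is extended by an arbitrary pure state of `W`.
  let w₀ : W := Classical.arbitrary W
  set K := R * Q * R with hK
  have hKp : K.PosSemidef := by
    have : K = (R * Q) * (R * Q).conjTranspose := by
      rw [Matrix.conjTranspose_mul, hRs, hQs, hK, ← Matrix.mul_assoc, Matrix.mul_assoc R Q Q, hQQ]
    rw [this]
    exact Matrix.posSemidef_self_mul_conjTranspose _
  have hK' : (K ⊗ₖ Matrix.single w₀ w₀ (1 : ℂ)).PosSemidef := by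
    exact hKp.kronecker (posSemidef_single w₀)
  refine ⟨G' * G'.conjTranspose + K ⊗ₖ Matrix.single w₀ w₀ 1,
    (Matrix.posSemidef_self_mul_conjTranspose _).add hK', ?_, ?_⟩
  · have h1 : traceRight A W (G' * G'.conjTranspose) = G * G.conjTranspose := by
      ext a b
      rw [traceRight_apply, Matrix.mul_apply, Fintype.sum_prod_type]
      rfl
    have h2 : traceRight A W (K ⊗ₖ Matrix.single w₀ w₀ (1 : ℂ)) = K := by
      ext a b
      simp [traceRight_apply, Matrix.single_apply]
    rw [map_add, h1, h2, hGG, hK, ← Matrix.add_mul, ← Matrix.mul_add, hCHC, Matrix.mul_one, hRR]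
  · have h1 : (V * S * G'.conjTranspose).trace = (T * G.conjTranspose).trace := by
      simp only [Matrix.trace, Matrix.diag_apply, Matrix.mul_apply (M := V * S),
        Matrix.mul_apply (M := T), Fintype.sum_prod_type]
      rfl
    have h2 : (T * G.conjTranspose).trace = (cfc Real.sqrt H).trace := by
      rw [← hHC, ← hYY, hYs, hGs, ← Matrix.mul_assoc, Matrix.trace_mul_comm]
      simp only [Matrix.mul_assoc]
    have h3 : (V * S * G'.conjTranspose).trace =
        (S * (V.conjTranspose * G').conjTranspose).trace := by
      rw [Matrix.mul_assoc, Matrix.trace_mul_comm, Matrix.conjTranspose_mul,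
        Matrix.conjTranspose_conjTranspose, Matrix.mul_assoc]
    have h4 : fidelity ρ ξ = (S * (V.conjTranspose * G').conjTranspose).trace.re := by
      rw [← h3, h1, h2]; rfl
    rw [h4]
    refine (re_trace_mul_conjTranspose_le _ _).trans ?_
    rw [← hS, hσ.2, Complex.one_re, Real.sqrt_one, one_mul]
    refine Real.sqrt_le_sqrt ?_
    rw [Matrix.mul_add, Matrix.add_mul, Matrix.trace_add, Complex.add_re,
      Matrix.conjTranspose_mul, Matrix.conjTranspose_conjTranspose]
    have h5 := Complex.re_le_re (hK'.conjTranspose_mul_mul_same V).trace_nonneg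
    simp only [Matrix.mul_assoc] at h5 ⊢
    exact le_add_of_nonneg_right h5

/-- The converse bound for a single use of the source: the signal states `σ x` of dimension `|M|`
are decoded by `D`. -/
lemma Ensemble.sum_fidelity_le {A X M : Type u} [Fintype A] [DecidableEq A] [Fintype X]
    [DecidableEq X] [Fintype M] (S : Ensemble A X) {α : ℝ} (hα : 1 < α)
    {D : Matrix M M ℂ →ₗ[ℂ] Matrix A A ℂ} (hD : IsCPTP D) {σ : X → Matrix M M ℂ}
    (hσ : ∀ x, IsDensity (σ x)) :
    ∑ x, S.prob x * fidelity (S.state x) (D (σ x)) ≤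
      (2 : ℝ) ^ ((α - 1) / (2 * α) *
        (Real.logb 2 (Fintype.card M) - renyiEoP α S.sourceState)) := by
  classical
  have nonempty_of : ∀ {B : Type u} [Fintype B] {ρ : Matrix B B ℂ}, IsDensity ρ → Nonempty B := by
    intro B _ ρ hρ
    by_contra h
    rw [not_nonempty_iff] at h
    simpa [Matrix.trace] using hρ.2
  obtain ⟨x₀⟩ : Nonempty X := by
    by_contra h
    rw [not_nonempty_iff] at h
    simpa using S.prob_sum
  have hA : Nonempty A := nonempty_of (S.state_density x₀)
  have hM : Nonempty M := nonempty_of (hσ x₀)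
  have : Nonempty (Fin (Fintype.card M)) := ⟨⟨0, Fintype.card_pos⟩⟩
  obtain ⟨V, hV, hDV⟩ := hD.exists_isometry
  choose ω hω hext hF using fun x => exists_extension_fidelity_le (S.state_density x).1 (hσ x) V
  set ν := ∑ x, (S.prob x : ℂ) • ω x with hν
  have hνd : IsDensity ν := by
    refine ⟨Matrix.posSemidef_sum _ fun x _ =>
      (hω x).smul (by exact_mod_cast S.prob_nonneg x), ?_⟩
    simp only [hν, Matrix.trace_sum, Matrix.trace_smul, ← trace_traceRight (ω _), hext,
      (S.state_density _).2, smul_eq_mul, mul_one]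
    exact_mod_cast S.prob_sum
  set t : X → ℝ := fun x => (V.conjTranspose * ω x * V).trace.re with ht
  have ht0 : ∀ x, 0 ≤ t x := fun x =>
    Complex.re_le_re ((hω x).conjTranspose_mul_mul_same V).trace_nonneg
  have hsum : ∑ x, S.prob x * t x = (V.conjTranspose * ν * V).trace.re := by
    simp [hν, ht, Matrix.mul_sum, Matrix.sum_mul, Matrix.trace_sum]
  have hjensen : ∑ x, S.prob x * Real.sqrt (t x) ≤ Real.sqrt (∑ x, S.prob x * t x) := by
    simpa using Real.strictConcaveOn_sqrt.concaveOn.le_map_sum (t := Finset.univ) (w := S.prob)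
      (p := t) (fun x _ => S.prob_nonneg x) S.prob_sum (fun x _ => ht0 x)
  have hE := S.renyiEoP_sourceState_le hα hω hext
  have hα0 : 0 < α := by linarith
  have hcard : (Fintype.card M : ℝ) = 2 ^ Real.logb 2 (Fintype.card M) :=
    (Real.rpow_logb two_pos (by norm_num) (by exact_mod_cast Fintype.card_pos)).symm
  calc ∑ x, S.prob x * fidelity (S.state x) (D (σ x))
      ≤ ∑ x, S.prob x * Real.sqrt (t x) := by
        refine Finset.sum_le_sum fun x _ => mul_le_mul_of_nonneg_left ?_ (S.prob_nonneg x)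
        rw [hDV]
        exact hF x
    _ ≤ Real.sqrt ((V.conjTranspose * ν * V).trace.re) := hsum ▸ hjensen
    _ ≤ Real.sqrt ((cfc (fun x : ℝ => x ^ α) ν).trace.re ^ (1 / α) *
          (Fintype.card M : ℝ) ^ ((α - 1) / α)) :=
        Real.sqrt_le_sqrt (trace_compression_le hνd.1 hV hα)
    _ = 2 ^ ((α - 1) / (2 * α) * (Real.logb 2 (Fintype.card M) - renyiEntropy α ν)) := by
        rw [hνd.trace_rpow_eq hα, Real.sqrt_eq_rpow]
        nth_rewrite 1 [hcard]
        rw [← Real.rpow_mul two_pos.le, ← Real.rpow_mul two_pos.le, ← Real.rpow_add two_pos,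
          ← Real.rpow_mul two_pos.le]
        congr 1
        field_simp
        ring
    _ ≤ _ := by
        refine Real.rpow_le_rpow_of_exponent_le one_le_two ?_
        refine mul_le_mul_of_nonneg_left (by linarith) (div_nonneg (by linarith) (by linarith))

end OneShot

end VisibleCompression

open VisibleCompression in
theorem mainTheorem3 {A X : Type u} [Fintype A] [DecidableEq A] [Fintype X] [DecidableEq X]
    (S : VisibleCompression.Ensemble A X) (α : ℝ) (hα : 1 < α) :
    Tendsto
        (fun n : ℕ => VisibleCompression.renyiEoP α
          (VisibleCompression.bipartitePow n S.sourceState) / (n : ℝ))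
        atTop (𝓝 (VisibleCompression.regularizedRenyiEoP α S.sourceState)) ∧
      ∀ (n : ℕ), 1 ≤ n → ∀ (M : Type u) [Fintype M]
        (code : VisibleCompression.VisibleCode A X n M),
        code.averageFidelity S ≤
          (2 : ℝ) ^ (-(n : ℝ) * ((α - 1) / (2 * α)) *
            (VisibleCompression.regularizedRenyiEoP α S.sourceState - code.rate)) := by
  have hd : ∀ n, IsDensity (bipartitePow n S.sourceState) := fun n =>
    S.bipartitePow_sourceState n ▸ (S.pow n).isDensity_sourceState
  have hsub := subadditive_renyiEoP hd hα
  have hbdd : BddBelow (Set.range fun n : ℕ =>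
      renyiEoP α (bipartitePow n S.sourceState) / (n : ℝ)) := by
    refine ⟨0, ?_⟩
    rintro _ ⟨n, rfl⟩
    exact div_nonneg (renyiEoP_nonneg (hd n) hα) n.cast_nonneg
  have hlim := hsub.tendsto_lim hbdd
  have hreg : regularizedRenyiEoP α S.sourceState = hsub.lim := hlim.limUnder_eq
  refine ⟨hreg ▸ hlim, fun n hn M _ code => ?_⟩
  have hn0 : (0 : ℝ) < n := by exact_mod_cast hn
  have hin : ∀ x : Fin n → X, IsDensity (S.statePow x ⊗ₖ Matrix.single x x (1 : ℂ)) := by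
    intro x
    have hx := (S.pow n).state_density x
    refine ⟨hx.1.kronecker (posSemidef_single x), ?_⟩
    rw [Matrix.trace_kronecker, Matrix.trace_single_eq_same, mul_one]
    exact hx.2
  refine ((S.pow n).sum_fidelity_le hα code.decoder_cptp
    fun x => code.encoder_cptp.isDensity (hin x)).trans ?_
  refine Real.rpow_le_rpow_of_exponent_le one_le_two ?_
  have hle : regularizedRenyiEoP α S.sourceState * n ≤ renyiEoP α (S.pow n).sourceState := by
    rw [hreg, ← S.bipartitePow_sourceState n, ← le_div_iff₀ hn0]
    exact hsub.lim_le_div hbdd (by omega)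
  have hrate : code.rate * n = Real.logb 2 (Fintype.card M) := by
    rw [VisibleCode.rate]; field_simp
  rw [show -(n : ℝ) * ((α - 1) / (2 * α)) * (regularizedRenyiEoP α S.sourceState - code.rate) =
    (α - 1) / (2 * α) * (code.rate * n - regularizedRenyiEoP α S.sourceState * n) by ring, hrate]
  exact mul_le_mul_of_nonneg_left (by linarith) (div_nonneg (by linarith) (by linarith))
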